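/- Let $G$ be a locally compact group and let $(A,\alpha)$ be a $G$-algebra, that is, $A$ is a (not necessarily unital) $C^*$-algebra and $\alpha\colon G\to\mathrm{Aut}(A)$ is a group homomorphism such that $g\mapsto\alpha_g(a)$ is norm-continuous for every $a\in A$. Let $A_\infty=\ell^\infty(\mathbb{N},A)/c_0(\mathbb{N},A)$ be the sequence algebra, with quotient map $\pi_A\colon \ell^\infty(\mathbb{N},A)\to A_\infty$. Regard $A\subseteq A_\infty$ via constant sequences, let $A_\infty\cap A'$ be the relative commutant, let $\mathrm{Ann}(A,A_\infty)=\{x\in A_\infty\colon xA=Ax=\{0\}\}$, which is a closed ideal of $A_\infty\cap A'$, and let $\kappa_A\colon A_\infty\cap A'\to F_\infty(A)=(A_\infty\cap A')/\mathrm{Ann}(A,A_\infty)$ be the quotient map. The action $\alpha$ induces, by termwise application, actions by automorphisms (not necessarily continuous) on $\ell^\infty(\mathbb{N},A)$, $A_\infty$, $A_\infty\cap A'$ and $F_\infty(A)$. Let $\ell^\infty_\alpha(\mathbb{N},A)$, $A_{\infty,\alpha}$ and $F_{\infty,\alpha}(A)$ denote the continuous parts of $\ell^\infty(\mathbb{N},A)$,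 $A_\infty$ and $F_\infty(A)$, that is, the subalgebras of those elements whose orbit map on $G$ is norm-continuous. An equivariant quotient map is a surjective $*$-homomorphism that intertwines the given actions and whose target carries the quotient norm of the domain modulo the kernel. 1. $\pi_A\big(\ell^\infty_\alpha(\mathbb{N},A)\big)=A_{\infty,\alpha}$, and hence the restriction $\pi_A\colon \ell^\infty_\alpha(\mathbb{N},A)\to A_{\infty,\alpha}$ is an equivariant quotient map. 2. If $A$ is separable, then $\kappa_A(A_{\infty,\alpha}\cap A')=F_{\infty,\alpha}(A)$, and hence the restriction $\kappa_A\colon A_{\infty,\alpha}\cap A'\to F_{\infty,\alpha}(A)$ is an equivariant quotient map. -/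

import Mathlib

open Filter Topology
open scoped ENNReal

noncomputable section

namespace SeqAlg

/-! ### Quotients of normed star algebras by closed star ideals -/

section Quotient

variable {B : Type*} [NonUnitalNormedRing B] [StarRing B] [NormedSpace ℂ B]

variable (B) in
/-- A closed, self-adjoint, two-sided ideal of a (complex) normed star algebra. -/
structure ClosedStarIdeal extends Submodule ℂ B where
  mul_left_mem : ∀ (b : B) {x : B}, x ∈ carrier → b * x ∈ carrier
  mul_right_mem : ∀ (b : B) {x : B}, x ∈ carrier → x * b ∈ carrier
  star_mem : ∀ {x : B}, x ∈ carrier → star x ∈ carrier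
  isClosed : IsClosed carrier

namespace ClosedStarIdeal

variable (I : ClosedStarIdeal B)

/-- The quotient of `B` by a closed star ideal; it carries the quotient norm, and the operations
induced by those of `B`. -/
def Quotient : Type _ := B ⧸ I.toSubmodule

instance instNormedAddCommGroup : NormedAddCommGroup I.Quotient :=
  haveI : IsClosed (I.toSubmodule : Set B) := I.isClosed
  inferInstanceAs (NormedAddCommGroup (B ⧸ I.toSubmodule))

instance instNormedSpace : NormedSpace ℂ I.Quotient where
  toModule := inferInstanceAs (Module ℂ (B ⧸ I.toSubmodule))
  norm_smul_le r x := norm_smul_le (α := ℂ) (β := B ⧸ I.toSubmodule) r x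

/-- The class of an element in the quotient. -/
def cls (b : B) : I.Quotient := Submodule.Quotient.mk (p := I.toSubmodule) b

theorem cls_surjective : Function.Surjective I.cls :=
  Submodule.Quotient.mk_surjective I.toSubmodule

theorem cls_eq_cls_iff {a b : B} : I.cls a = I.cls b ↔ a - b ∈ I.toSubmodule :=
  Submodule.Quotient.eq I.toSubmodule

theorem cls_add (a b : B) : I.cls (a + b) = I.cls a + I.cls b := rfl

theorem cls_smul (r : ℂ) (a : B) : I.cls (r • a) = r • I.cls a := rfl

theorem cls_zero : I.cls 0 = 0 := rfl

theorem norm_cls_le (a : B) : ‖I.cls a‖ ≤ ‖a‖ :=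
  Submodule.Quotient.norm_mk_le I.toSubmodule a

theorem exists_norm_lt (x : I.Quotient) {ε : ℝ} (hε : 0 < ε) :
    ∃ a : B, I.cls a = x ∧ ‖a‖ < ‖x‖ + ε :=
  Submodule.Quotient.norm_mk_lt (S := I.toSubmodule) x hε

instance instMul : Mul I.Quotient where
  mul := Quotient.map₂ (· * ·) (by
    intro a a' h b b' h'
    have h1 : a - a' ∈ I.toSubmodule := (Submodule.quotientRel_def I.toSubmodule).1 h
    have h2 : b - b' ∈ I.toSubmodule := (Submodule.quotientRel_def I.toSubmodule).1 h'
    refine (Submodule.quotientRel_def I.toSubmodule).2 ?_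
    have e : a * b - a' * b' = (a - a') * b + a' * (b - b') := by noncomm_ring
    change a * b - a' * b' ∈ I.toSubmodule
    rw [e]
    exact I.toSubmodule.add_mem (I.mul_right_mem b h1) (I.mul_left_mem a' h2))

theorem cls_mul (a b : B) : I.cls (a * b) = I.cls a * I.cls b := rfl

instance instStar : Star I.Quotient where
  star := Quotient.map star (by
    intro a a' h
    have h1 : a - a' ∈ I.toSubmodule := (Submodule.quotientRel_def I.toSubmodule).1 h
    refine (Submodule.quotientRel_def I.toSubmodule).2 ?_
    rw [← star_sub]
    exact I.star_mem h1)

theorem cls_star (a : B) : I.cls (star a) = star (I.cls a) := rfl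

instance instNonUnitalNormedRing : NonUnitalNormedRing I.Quotient where
  __ := I.instNormedAddCommGroup
  __ := I.instMul
  left_distrib x y z := by
    obtain ⟨a, rfl⟩ := I.cls_surjective x
    obtain ⟨b, rfl⟩ := I.cls_surjective y
    obtain ⟨c, rfl⟩ := I.cls_surjective z
    change I.cls (a * (b + c)) = I.cls (a * b + a * c)
    rw [mul_add]
  right_distrib x y z := by
    obtain ⟨a, rfl⟩ := I.cls_surjective x
    obtain ⟨b, rfl⟩ := I.cls_surjective y
    obtain ⟨c, rfl⟩ := I.cls_surjective z
    change I.cls ((a + b) * c) = I.cls (a * c + b * c)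
    rw [add_mul]
  zero_mul x := by
    obtain ⟨a, rfl⟩ := I.cls_surjective x
    change I.cls (0 * a) = I.cls 0
    rw [zero_mul]
  mul_zero x := by
    obtain ⟨a, rfl⟩ := I.cls_surjective x
    change I.cls (a * 0) = I.cls 0
    rw [mul_zero]
  mul_assoc x y z := by
    obtain ⟨a, rfl⟩ := I.cls_surjective x
    obtain ⟨b, rfl⟩ := I.cls_surjective y
    obtain ⟨c, rfl⟩ := I.cls_surjective z
    change I.cls (a * b * c) = I.cls (a * (b * c))
    rw [mul_assoc]
  norm_mul_le x y := by
    have key : ∀ ε : ℝ, 0 < ε → ‖x * y‖ ≤ (‖x‖ + ε) * (‖y‖ + ε) := by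
      intro ε hε
      obtain ⟨a, rfl, ha⟩ := I.exists_norm_lt x hε
      obtain ⟨b, rfl, hb⟩ := I.exists_norm_lt y hε
      calc ‖I.cls (a * b)‖ ≤ ‖a * b‖ := I.norm_cls_le _
        _ ≤ ‖a‖ * ‖b‖ := norm_mul_le a b
        _ ≤ _ := by gcongr
    have lim : Tendsto (fun ε : ℝ => (‖x‖ + ε) * (‖y‖ + ε)) (𝓝[>] 0) (𝓝 (‖x‖ * ‖y‖)) := by
      have h : ContinuousAt (fun ε : ℝ => (‖x‖ + ε) * (‖y‖ + ε)) 0 := by fun_prop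
      have h' := h.tendsto
      simp only [add_zero] at h'
      exact h'.mono_left nhdsWithin_le_nhds
    exact ge_of_tendsto lim (eventually_mem_nhdsWithin.mono fun ε hε => key ε hε)

instance instStarRing : StarRing I.Quotient where
  star_involutive x := by
    obtain ⟨a, rfl⟩ := I.cls_surjective x
    change I.cls (star (star a)) = I.cls a
    rw [star_star]
  star_mul x y := by
    obtain ⟨a, rfl⟩ := I.cls_surjective x
    obtain ⟨b, rfl⟩ := I.cls_surjective y
    change I.cls (star (a * b)) = I.cls (star b * star a)
    rw [star_mul]
  star_add x y := by
    obtain ⟨a, rfl⟩ := I.cls_surjective x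
    obtain ⟨b, rfl⟩ := I.cls_surjective y
    change I.cls (star (a + b)) = I.cls (star a + star b)
    rw [star_add]

instance instNormedStarGroup [NormedStarGroup B] : NormedStarGroup I.Quotient where
  norm_star_le x := by
    refine le_of_forall_pos_le_add fun ε hε => ?_
    obtain ⟨a, rfl, ha⟩ := I.exists_norm_lt x hε
    calc ‖I.cls (star a)‖ ≤ ‖star a‖ := I.norm_cls_le _
      _ = ‖a‖ := norm_star a
      _ ≤ _ := ha.le

instance instIsScalarTower [IsScalarTower ℂ B B] : IsScalarTower ℂ I.Quotient I.Quotient where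
  smul_assoc r x y := by
    obtain ⟨a, rfl⟩ := I.cls_surjective x
    obtain ⟨b, rfl⟩ := I.cls_surjective y
    change I.cls ((r • a) * b) = I.cls (r • (a * b))
    rw [smul_mul_assoc]

instance instSMulCommClass [SMulCommClass ℂ B B] : SMulCommClass ℂ I.Quotient I.Quotient where
  smul_comm r x y := by
    obtain ⟨a, rfl⟩ := I.cls_surjective x
    obtain ⟨b, rfl⟩ := I.cls_surjective y
    change I.cls (r • (a * b)) = I.cls (a * (r • b))
    rw [mul_smul_comm]

instance instStarModule [StarModule ℂ B] : StarModule ℂ I.Quotient where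
  star_smul r x := by
    obtain ⟨a, rfl⟩ := I.cls_surjective x
    change I.cls (star (r • a)) = I.cls (star r • star a)
    rw [star_smul]

/-- The canonical quotient homomorphism. -/
def mkHom : B →⋆ₙₐ[ℂ] I.Quotient where
  toFun := I.cls
  map_smul' _ _ := rfl
  map_zero' := rfl
  map_add' _ _ := rfl
  map_mul' _ _ := rfl
  map_star' _ := rfl

end ClosedStarIdeal

end Quotient

/-! ### Actions by star automorphisms -/

section Actions

variable {G : Type*} [Group G]
variable {B : Type*} [NonUnitalNormedRing B] [StarRing B] [NormedSpace ℂ B]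
variable {C : Type*} [NonUnitalNormedRing C] [StarRing C] [NormedSpace ℂ C]

/-- The action is continuous for the point-norm topology. -/
def IsContinuousAction [TopologicalSpace G] (β : G →* (B ≃⋆ₐ[ℂ] B)) : Prop :=
  ∀ b : B, Continuous fun g => β g b

/-- The continuous part: the elements whose orbit map is norm-continuous. -/
def continuousPart [TopologicalSpace G] [NormedStarGroup B] (β : G →* (B ≃⋆ₐ[ℂ] B)) :
    NonUnitalStarSubalgebra ℂ B where
  carrier := {b | Continuous fun g => β g b}
  zero_mem' := by
    change Continuous fun g => β g 0
    simp only [map_zero]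
    exact continuous_const
  add_mem' {a b} ha hb := by
    change Continuous fun g => β g (a + b)
    simp only [map_add]
    exact Continuous.add ha hb
  mul_mem' {a b} ha hb := by
    change Continuous fun g => β g (a * b)
    simp only [map_mul]
    exact Continuous.mul ha hb
  smul_mem' r a ha := by
    change Continuous fun g => β g (r • a)
    simp only [map_smul]
    exact Continuous.const_smul ha r
  star_mem' {a} ha := by
    change Continuous fun g => β g (star a)
    simp only [map_star]
    exact Continuous.star ha

theorem continuousPart_invariant [TopologicalSpace G] [ContinuousMul G] [NormedStarGroup B]
    (β : G →* (B ≃⋆ₐ[ℂ] B)) (g : G) (b : B) (hb : b ∈ continuousPart β) :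
    β g b ∈ continuousPart β := by
  have hb' : Continuous fun h => β h b := hb
  have h1 : Continuous fun h => β (h * g) b := hb'.comp (continuous_mul_const g)
  have h2 : (fun h => β h (β g b)) = fun h => β (h * g) b := by
    funext h
    rw [map_mul]
    rfl
  change Continuous fun h => β h (β g b)
  rw [h2]
  exact h1

theorem apply_inv_apply (β : G →* (B ≃⋆ₐ[ℂ] B)) (g : G) (b : B) : β g (β g⁻¹ b) = b := by
  change (β g * β g⁻¹) b = b
  rw [← map_mul, mul_inv_cancel, map_one]
  rfl

theorem inv_apply_apply (β : G →* (B ≃⋆ₐ[ℂ] B)) (g : G) (b : B) : β g⁻¹ (β g b) = b := by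
  change (β g⁻¹ * β g) b = b
  rw [← map_mul, inv_mul_cancel, map_one]
  rfl

/-- The restriction of an action to an invariant star subalgebra. -/
def restrictAction (β : G →* (B ≃⋆ₐ[ℂ] B)) (S : NonUnitalStarSubalgebra ℂ B)
    (hS : ∀ g : G, ∀ b ∈ S, β g b ∈ S) : G →* (S ≃⋆ₐ[ℂ] S) where
  toFun g :=
    { toFun := fun b => ⟨β g b, hS g b b.2⟩
      invFun := fun b => ⟨β g⁻¹ b, hS g⁻¹ b b.2⟩
      left_inv := fun b => Subtype.ext (inv_apply_apply β g b)
      right_inv := fun b => Subtype.ext (apply_inv_apply β g b)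
      map_mul' := fun a b => Subtype.ext (map_mul (β g) (a : B) b)
      map_add' := fun a b => Subtype.ext (map_add (β g) (a : B) b)
      map_star' := fun a => Subtype.ext (map_star (β g) (a : B))
      map_smul' := fun r a => Subtype.ext (map_smul (β g) r (a : B)) }
  map_one' := by
    ext b
    change β 1 (b : B) = b
    rw [map_one]
    rfl
  map_mul' g h := by
    ext b
    change β (g * h) (b : B) = β g (β h b)
    rw [map_mul]
    rfl

/-- The action induced on the quotient by an invariant closed star ideal. -/
def quotientAction (β : G →* (B ≃⋆ₐ[ℂ] B)) (I : ClosedStarIdeal B)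
    (hI : ∀ g : G, ∀ b ∈ I.toSubmodule, β g b ∈ I.toSubmodule) :
    G →* (I.Quotient ≃⋆ₐ[ℂ] I.Quotient) :=
  let f : G → I.Quotient → I.Quotient := fun g => Quotient.map (β g) (by
    intro a a' h
    have h1 : a - a' ∈ I.toSubmodule := (Submodule.quotientRel_def I.toSubmodule).1 h
    refine (Submodule.quotientRel_def I.toSubmodule).2 ?_
    rw [← map_sub]
    exact hI g _ h1)
  have hf : ∀ (g : G) (b : B), f g (I.cls b) = I.cls (β g b) := fun _ _ => rfl
  { toFun := fun g =>
      { toFun := f g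
        invFun := f g⁻¹
        left_inv := fun x => by
          obtain ⟨a, rfl⟩ := I.cls_surjective x
          rw [hf, hf, inv_apply_apply]
        right_inv := fun x => by
          obtain ⟨a, rfl⟩ := I.cls_surjective x
          rw [hf, hf, apply_inv_apply]
        map_mul' := fun x y => by
          obtain ⟨a, rfl⟩ := I.cls_surjective x
          obtain ⟨b, rfl⟩ := I.cls_surjective y
          rw [← I.cls_mul, hf, hf, hf, map_mul, I.cls_mul]
        map_add' := fun x y => by
          obtain ⟨a, rfl⟩ := I.cls_surjective x
          obtain ⟨b, rfl⟩ := I.cls_surjective y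
          rw [← I.cls_add, hf, hf, hf, map_add, I.cls_add]
        map_star' := fun x => by
          obtain ⟨a, rfl⟩ := I.cls_surjective x
          rw [← I.cls_star, hf, hf, map_star, I.cls_star]
        map_smul' := fun r x => by
          obtain ⟨a, rfl⟩ := I.cls_surjective x
          rw [← I.cls_smul, hf, hf, map_smul, I.cls_smul] }
    map_one' := by
      ext x
      obtain ⟨a, rfl⟩ := I.cls_surjective x
      change I.cls (β 1 a) = I.cls a
      rw [map_one]
      rfl
    map_mul' := fun g h => by
      ext x
      obtain ⟨a, rfl⟩ := I.cls_surjective x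
      change I.cls (β (g * h) a) = I.cls (β g (β h a))
      rw [map_mul]
      rfl }

theorem quotientAction_cls (β : G →* (B ≃⋆ₐ[ℂ] B)) (I : ClosedStarIdeal B)
    (hI : ∀ g : G, ∀ b ∈ I.toSubmodule, β g b ∈ I.toSubmodule) (g : G) (b : B) :
    quotientAction β I hI g (I.cls b) = I.cls (β g b) := rfl

/-- An equivariant quotient map: an equivariant surjective star homomorphism under which the
target carries the quotient norm of the domain modulo the kernel. -/
structure IsEquivariantQuotientMap (β : G →* (B ≃⋆ₐ[ℂ] B)) (γ : G →* (C ≃⋆ₐ[ℂ] C))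
    (φ : B →⋆ₙₐ[ℂ] C) : Prop where
  equivariant : ∀ (g : G) (b : B), φ (β g b) = γ g (φ b)
  surjective : Function.Surjective φ
  norm_eq : ∀ b : B, ‖φ b‖ = sInf ((fun k => ‖b + k‖) '' {k : B | φ k = 0})

end Actions

/-! ### Sequence algebras -/

section Sequences

variable (A : Type*) [NonUnitalCStarAlgebra A]

/-- The bounded sequences in `A`. -/
abbrev LInfty : Type _ := lp (fun _ : ℕ => A) ∞

/-- The ideal of sequences converging to zero. -/
def cZero : ClosedStarIdeal (LInfty A) where
  carrier := {x | Tendsto (fun n => x n) atTop (𝓝 0)}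
  zero_mem' := by
    change Tendsto (fun _ : ℕ => (0 : A)) atTop (𝓝 0)
    exact tendsto_const_nhds
  add_mem' {x y} hx hy := by
    have h := Tendsto.add hx hy
    rw [add_zero] at h
    exact h
  smul_mem' r x hx := by
    have h := Tendsto.const_smul hx r
    rw [smul_zero] at h
    exact h
  mul_left_mem b x hx := by
    have hx' : Tendsto (fun n => x n) atTop (𝓝 0) := hx
    refine squeeze_zero_norm (a := fun n => ‖b‖ * ‖x n‖) (fun n => ?_) ?_
    · calc ‖b n * x n‖ ≤ ‖b n‖ * ‖x n‖ := norm_mul_le _ _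
        _ ≤ _ := by
          gcongr
          exact lp.norm_apply_le_norm ENNReal.top_ne_zero b n
    · simpa using (hx'.norm).const_mul ‖b‖
  mul_right_mem b x hx := by
    have hx' : Tendsto (fun n => x n) atTop (𝓝 0) := hx
    refine squeeze_zero_norm (a := fun n => ‖x n‖ * ‖b‖) (fun n => ?_) ?_
    · calc ‖x n * b n‖ ≤ ‖x n‖ * ‖b n‖ := norm_mul_le _ _
        _ ≤ _ := by
          gcongr
          exact lp.norm_apply_le_norm ENNReal.top_ne_zero b n
    · simpa using (hx'.norm).mul_const ‖b‖
  star_mem {x} hx := by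
    have h := Tendsto.star hx
    rw [star_zero] at h
    exact h
  isClosed := by
    refine isClosed_of_closure_subset fun x hx => ?_
    change Tendsto (fun n => x n) atTop (𝓝 0)
    rw [Metric.tendsto_atTop]
    intro ε hε
    obtain ⟨y, hy, hxy⟩ := Metric.mem_closure_iff.1 hx (ε / 2) (half_pos hε)
    obtain ⟨N, hN⟩ := Metric.tendsto_atTop.1 hy (ε / 2) (half_pos hε)
    refine ⟨N, fun n hn => ?_⟩
    have h1 : dist (x n) (y n) ≤ dist x y := by
      rw [dist_eq_norm, dist_eq_norm]
      exact lp.norm_apply_le_norm ENNReal.top_ne_zero (x - y) n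
    calc dist (x n) 0 ≤ dist (x n) (y n) + dist (y n) 0 := dist_triangle _ _ _
      _ < ε / 2 + ε / 2 := add_lt_add (lt_of_le_of_lt h1 hxy) (hN n hn)
      _ = ε := add_halves ε

/-- The sequence algebra `A_∞`: bounded sequences modulo null sequences. -/
abbrev SeqAlgebra : Type _ := (cZero A).Quotient

/-- The quotient map `π_A` from bounded sequences to the sequence algebra. -/
def piMap : LInfty A →⋆ₙₐ[ℂ] SeqAlgebra A := (cZero A).mkHom

/-- The constant sequence with value `a`. -/
def constSeq (a : A) : LInfty A :=
  ⟨fun _ => a, memℓp_infty ⟨‖a‖, by rintro _ ⟨_, rfl⟩; exact le_rfl⟩⟩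

/-- The class of a constant sequence; this is the canonical copy of `A` in `A_∞`. -/
def constClass (a : A) : SeqAlgebra A := piMap A (constSeq A a)

theorem constClass_star (a : A) : constClass A (star a) = star (constClass A a) := rfl

/-- The central sequence algebra `A_∞ ∩ A'`. -/
def centralSeq : NonUnitalStarSubalgebra ℂ (SeqAlgebra A) :=
  NonUnitalStarSubalgebra.centralizer ℂ (Set.range (constClass A))

theorem mem_centralSeq {x : SeqAlgebra A} :
    x ∈ centralSeq A ↔ ∀ a : A, constClass A a * x = x * constClass A a := by
  rw [centralSeq, NonUnitalStarSubalgebra.mem_centralizer_iff]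
  constructor
  · intro h a
    exact (h _ ⟨a, rfl⟩).1
  · rintro h _ ⟨a, rfl⟩
    exact ⟨h a, h (star a)⟩

instance : NormedStarGroup (centralSeq A) where
  norm_star_le x := NormedStarGroup.norm_star_le (x : SeqAlgebra A)

/-- The annihilator of `A` in `A_∞`, as an ideal of `A_∞ ∩ A'`. It consists of all `x` in `A_∞` with
`x A = A x = 0`; such elements automatically lie in `A_∞ ∩ A'`. -/
def annIdeal : ClosedStarIdeal (centralSeq A) where
  carrier := {x | ∀ a : A, (x : SeqAlgebra A) * constClass A a = 0 ∧
    constClass A a * (x : SeqAlgebra A) = 0}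
  zero_mem' a := ⟨zero_mul _, mul_zero _⟩
  add_mem' {x y} hx hy a := by
    refine ⟨?_, ?_⟩
    · change ((x : SeqAlgebra A) + y) * constClass A a = 0
      rw [add_mul, (hx a).1, (hy a).1, add_zero]
    · change constClass A a * ((x : SeqAlgebra A) + y) = 0
      rw [mul_add, (hx a).2, (hy a).2, add_zero]
  smul_mem' r x hx a := by
    refine ⟨?_, ?_⟩
    · change (r • (x : SeqAlgebra A)) * constClass A a = 0
      rw [smul_mul_assoc, (hx a).1, smul_zero]
    · change constClass A a * (r • (x : SeqAlgebra A)) = 0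
      rw [mul_smul_comm, (hx a).2, smul_zero]
  mul_left_mem b x hx a := by
    refine ⟨?_, ?_⟩
    · change ((b : SeqAlgebra A) * x) * constClass A a = 0
      rw [mul_assoc, (hx a).1, mul_zero]
    · change constClass A a * ((b : SeqAlgebra A) * x) = 0
      rw [← mul_assoc, (mem_centralSeq A).1 b.2 a, mul_assoc, (hx a).2, mul_zero]
  mul_right_mem b x hx a := by
    refine ⟨?_, ?_⟩
    · change ((x : SeqAlgebra A) * b) * constClass A a = 0
      rw [mul_assoc, ← (mem_centralSeq A).1 b.2 a, ← mul_assoc, (hx a).1, zero_mul]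
    · change constClass A a * ((x : SeqAlgebra A) * b) = 0
      rw [← mul_assoc, (hx a).2, zero_mul]
  star_mem {x} hx a := by
    have h := hx (star a)
    refine ⟨?_, ?_⟩
    · have h2 := congrArg star h.2
      rw [constClass_star, star_mul, star_star, star_zero] at h2
      exact h2
    · have h1 := congrArg star h.1
      rw [constClass_star, star_mul, star_star, star_zero] at h1
      exact h1
  isClosed := by
    have h : {x : centralSeq A | ∀ a : A, (x : SeqAlgebra A) * constClass A a = 0 ∧
        constClass A a * (x : SeqAlgebra A) = 0} =
        ⋂ a : A, {x : centralSeq A | (x : SeqAlgebra A) * constClass A a = 0} ∩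
          {x : centralSeq A | constClass A a * (x : SeqAlgebra A) = 0} := by
      ext x
      rw [Set.mem_iInter]
      exact Iff.rfl
    change IsClosed {x : centralSeq A | ∀ a : A, (x : SeqAlgebra A) * constClass A a = 0 ∧
        constClass A a * (x : SeqAlgebra A) = 0}
    rw [h]
    refine isClosed_iInter fun a => IsClosed.inter ?_ ?_
    · exact isClosed_eq (continuous_subtype_val.mul continuous_const) continuous_const
    · exact isClosed_eq ((continuous_const_mul (constClass A a)).comp continuous_subtype_val)
        continuous_const

/-- The algebra `F_∞(A)`: the central sequence algebra modulo the annihilator of `A`. -/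
abbrev FAlgebra : Type _ := (annIdeal A).Quotient

/-- The quotient map `κ_A` from the central sequence algebra to `F_∞(A)`. -/
def kappaMap : centralSeq A →⋆ₙₐ[ℂ] FAlgebra A := (annIdeal A).mkHom

end Sequences

/-! ### The induced actions -/

section InducedActions

variable {G : Type*} [Group G] {A : Type*} [NonUnitalCStarAlgebra A]
variable (α : G →* (A ≃⋆ₐ[ℂ] A))

/-- Termwise application of an automorphism to a bounded sequence. -/
def mapSeq (g : G) (x : LInfty A) : LInfty A :=
  ⟨fun n => α g (x n), memℓp_infty ⟨‖x‖, by
    rintro _ ⟨n, rfl⟩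
    change ‖α g (x n)‖ ≤ ‖x‖
    rw [StarAlgEquiv.norm_map]
    exact lp.norm_apply_le_norm ENNReal.top_ne_zero x n⟩⟩

/-- The action on bounded sequences induced by `α`, acting termwise. -/
def linftyAction : G →* (LInfty A ≃⋆ₐ[ℂ] LInfty A) where
  toFun g :=
    { toFun := mapSeq α g
      invFun := mapSeq α g⁻¹
      left_inv := fun x => lp.ext (funext fun n => inv_apply_apply α g (x n))
      right_inv := fun x => lp.ext (funext fun n => apply_inv_apply α g (x n))
      map_mul' := fun x y => lp.ext (funext fun n => map_mul (α g) (x n) (y n))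
      map_add' := fun x y => lp.ext (funext fun n => map_add (α g) (x n) (y n))
      map_star' := fun x => lp.ext (funext fun n => map_star (α g) (x n))
      map_smul' := fun r x => lp.ext (funext fun n => map_smul (α g) r (x n)) }
  map_one' := by
    ext x n
    change α 1 (x n) = x n
    rw [map_one]
    rfl
  map_mul' g h := by
    ext x n
    change α (g * h) (x n) = α g (α h (x n))
    rw [map_mul]
    rfl

theorem linftyAction_mem_cZero (g : G) (x : LInfty A) (hx : x ∈ (cZero A).toSubmodule) :
    linftyAction α g x ∈ (cZero A).toSubmodule := by
  have hx' : Tendsto (fun n => x n) atTop (𝓝 0) := hx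
  change Tendsto (fun n => α g (x n)) atTop (𝓝 0)
  rw [tendsto_zero_iff_norm_tendsto_zero] at hx' ⊢
  simpa only [StarAlgEquiv.norm_map] using hx'

/-- The action induced by `α` on the sequence algebra `A_∞`. -/
def seqAction : G →* (SeqAlgebra A ≃⋆ₐ[ℂ] SeqAlgebra A) :=
  quotientAction (linftyAction α) (cZero A) (linftyAction_mem_cZero α)

theorem seqAction_constClass (g : G) (a : A) :
    seqAction α g (constClass A a) = constClass A (α g a) := rfl

theorem seqAction_mem_centralSeq (g : G) (x : SeqAlgebra A) (hx : x ∈ centralSeq A) :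
    seqAction α g x ∈ centralSeq A := by
  rw [mem_centralSeq] at hx ⊢
  intro a
  have h := congrArg (seqAction α g) (hx (α g⁻¹ a))
  rwa [map_mul, map_mul, seqAction_constClass, apply_inv_apply] at h

/-- The action induced by `α` on the central sequence algebra `A_∞ ∩ A'`. -/
def centralAction : G →* (centralSeq A ≃⋆ₐ[ℂ] centralSeq A) :=
  restrictAction (seqAction α) (centralSeq A) (seqAction_mem_centralSeq α)

theorem centralAction_mem_annIdeal (g : G) (x : centralSeq A)
    (hx : x ∈ (annIdeal A).toSubmodule) :
    centralAction α g x ∈ (annIdeal A).toSubmodule := by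
  intro a
  have h := hx (α g⁻¹ a)
  have h1 := congrArg (seqAction α g) h.1
  have h2 := congrArg (seqAction α g) h.2
  rw [map_mul, seqAction_constClass, apply_inv_apply, map_zero] at h1 h2
  exact ⟨h1, h2⟩

/-- The action induced by `α` on `F_∞(A)`. -/
def fAction : G →* (FAlgebra A ≃⋆ₐ[ℂ] FAlgebra A) :=
  quotientAction (centralAction α) (annIdeal A) (centralAction_mem_annIdeal α)

variable [TopologicalSpace G]

/-- The algebra `A_{∞,α} ∩ A'`, the intersection of the continuous part of `A_∞` with `A'`,
regarded as a subalgebra of `A_∞ ∩ A'`. -/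
def centralContinuousPart : NonUnitalStarSubalgebra ℂ (centralSeq A) :=
  (continuousPart (seqAction α)).comap (NonUnitalStarSubalgebraClass.subtype (centralSeq A))

variable [ContinuousMul G]

theorem centralContinuousPart_invariant (g : G) (x : centralSeq A)
    (hx : x ∈ centralContinuousPart α) : centralAction α g x ∈ centralContinuousPart α :=
  continuousPart_invariant (seqAction α) g (x : SeqAlgebra A) hx

/-- The restriction of the induced action to `A_{∞,α} ∩ A'`. -/
def centralContinuousAction :
    G →* (centralContinuousPart α ≃⋆ₐ[ℂ] centralContinuousPart α) :=
  restrictAction (centralAction α) (centralContinuousPart α) (centralContinuousPart_invariant α)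

/-- The restriction of an action to its continuous part. -/
def continuousPartAction {B : Type*} [NonUnitalNormedRing B] [StarRing B] [NormedSpace ℂ B]
    [NormedStarGroup B] (β : G →* (B ≃⋆ₐ[ℂ] B)) :
    G →* (continuousPart β ≃⋆ₐ[ℂ] continuousPart β) :=
  restrictAction β (continuousPart β) (continuousPart_invariant β)

end InducedActions

end SeqAlg

end

namespace SeqAlg

open MeasureTheory

/-! ### Lifting from approximate lifts -/

/-! The substance is that a continuous class lifts, with control of the norm, to a bounded sequence
whose orbit map is continuous. Given a representative `x`, average it termwise: `y n = ∫ f(g) α_g(x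
n) dg`, with `f` a compactly supported continuous probability density for Haar measure concentrated
near `1`. Averaging does not increase the norm, and `y` always has a continuous orbit, because `α_h`
only translates `f` and translation of `f` is continuous in `L¹`, a bound uniform in `n`
(`average_mem_continuousPart`).

If the class of `x` moves by less than `δ` on the support of `f`, then for each such `g` the
difference `α_g(x n) - x n` is eventually at most any prescribed bound larger than `δ`. How large
`n` must be depends on `g`, but dominated convergence along the sequence removes this dependence, so
`y` is a lift up to error `δ` (`exists_approx_lift_piMap`). Correcting the error repeatedly and
summing the corrections in a complete space gives exact lifts of almost the same norm
(`exists_lift_of_approx`). Such lifts yield surjectivity and the quotient norm at once.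

For `F_∞(A)` the representative in `A_∞` need not have a continuous orbit; only its products with
elements of `A` are controlled. Averaging is therefore tested after right multiplication by each `a`
in the unit ball. Separability enters in `norm_kappaMap_le_of_forall_mul`: a sequential approximate
unit, inserted slowly along the sequence, shows that these products determine the norm in `F_∞(A)`.
-/

/-- A contractive additive map on a complete group that admits norm-controlled approximate lifts
admits norm-controlled lifts. -/
theorem exists_lift_of_approx {E F : Type*} [NormedAddCommGroup E] [CompleteSpace E]
    [NormedAddCommGroup F] (T : E →+ F) (hT : ∀ y, ‖T y‖ ≤ ‖y‖)
    (happ : ∀ (z : F) (δ : ℝ), 0 < δ → ∃ y, ‖y‖ ≤ ‖z‖ + δ ∧ ‖z - T y‖ ≤ δ)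
    (z : F) {ε : ℝ} (hε : 0 < ε) : ∃ y, T y = z ∧ ‖y‖ ≤ ‖z‖ + ε := by
  choose! app happ1 happ2 using happ
  -- The coefficient 3 in `hy` is one `δ n` of tolerance plus the residual bound `δ (n - 1) = 2 * δ
  -- n`; the factor `1 / 6` makes `3 * δ n` sum to `ε`.
  set δ : ℕ → ℝ := fun n => ε / 6 * (1 / 2) ^ n with hδ
  have hδpos : ∀ n, 0 < δ n := fun n => by positivity
  have hδsucc : ∀ n, δ n = 2 * δ (n + 1) := fun n => by simp only [hδ, pow_succ]; ring
  -- `r n` is the part of `z` still to be lifted, and `y n` is an approximate lift of it.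
  let r : ℕ → F := fun n => Nat.rec z (fun n w => w - T (app w (δ n))) n
  let y : ℕ → E := fun n => app (r n) (δ n)
  have hr : ∀ n, r (n + 1) = r n - T (y n) := fun n => rfl
  have hrn : ∀ n, ‖r (n + 1)‖ ≤ δ n := fun n => happ2 _ _ (hδpos n)
  have hy : ∀ n, ‖y n‖ ≤ (if n = 0 then ‖z‖ else 0) + 3 * δ n := by
    intro n
    have h := happ1 (r n) (δ n) (hδpos n)
    rcases n with _ | n
    · have h0 := hδpos 0
      have hz : r 0 = z := rfl
      rw [hz] at h
      simp only [if_true]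
      change ‖app z (δ 0)‖ ≤ _
      linarith
    · have h1 := hrn n
      have h2 := hδsucc n
      simp only [Nat.succ_ne_zero, if_false]
      change ‖app (r (n + 1)) (δ (n + 1))‖ ≤ _
      linarith
  have hsum : HasSum (fun n => (if n = 0 then ‖z‖ else 0) + 3 * δ n) (‖z‖ + ε) := by
    have h1 : HasSum (fun n : ℕ => if n = 0 then ‖z‖ else 0) ‖z‖ := hasSum_ite_eq 0 ‖z‖
    have h2 := (hasSum_geometric_two.mul_left (ε / 6)).mul_left 3
    convert h1.add h2 using 1
    ring
  have hys : Summable y := Summable.of_norm_bounded hsum.summable hy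
  refine ⟨∑' n, y n, ?_, tsum_of_norm_bounded hsum hy⟩
  have hTc : Continuous T := AddMonoidHomClass.continuous_of_bound T 1 fun x => by
    simpa using hT x
  have h1 : Tendsto (fun n => T (∑ i ∈ Finset.range n, y i)) atTop (𝓝 (T (∑' n, y n))) :=
    (hTc.tendsto _).comp hys.hasSum.tendsto_sum_nat
  have h2 : ∀ n, T (∑ i ∈ Finset.range n, y i) = z - r n := by
    intro n
    induction n with
    | zero => change T 0 = z - z; simp
    | succ n ih => rw [Finset.sum_range_succ, map_add, ih, hr]; abel
  have h3 : Tendsto r atTop (𝓝 0) := by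
    rw [← tendsto_add_atTop_iff_nat 1]
    refine squeeze_zero_norm hrn ?_
    simpa [hδ] using (tendsto_pow_atTop_nhds_zero_of_lt_one (by norm_num : (0 : ℝ) ≤ 1 / 2)
      (by norm_num)).const_mul (ε / 6)
  have h4 : Tendsto (fun n => T (∑ i ∈ Finset.range n, y i)) atTop (𝓝 (z - 0)) := by
    simp only [h2]
    exact tendsto_const_nhds.sub h3
  rw [sub_zero] at h4
  exact tendsto_nhds_unique h1 h4

/-- A contractive homomorphism with norm-controlled lifts induces the quotient norm. -/
theorem norm_eq_sInf_of_lift {E F : Type*} [NormedAddCommGroup E] [NormedAddCommGroup F]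
    (T : E →+ F) (hT : ∀ y, ‖T y‖ ≤ ‖y‖)
    (hlift : ∀ (z : F) (ε : ℝ), 0 < ε → ∃ y, T y = z ∧ ‖y‖ ≤ ‖z‖ + ε) (b : E) :
    ‖T b‖ = sInf ((fun k => ‖b + k‖) '' {k : E | T k = 0}) := by
  refine le_antisymm ?_ ?_
  · refine le_csInf ⟨_, 0, map_zero T, rfl⟩ ?_
    rintro _ ⟨k, hk, rfl⟩
    have h := hT (b + k)
    rwa [map_add, show T k = 0 from hk, add_zero] at h
  · refine le_of_forall_pos_le_add fun ε hε => ?_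
    obtain ⟨y, hy, hyn⟩ := hlift (T b) ε hε
    -- A nearly norm-minimal lift `y` of `T b` differs from `b` by a kernel element, so it competes
    -- in the infimum.
    have hk : y - b ∈ {k : E | T k = 0} := by
      change T (y - b) = 0
      rw [map_sub, hy, sub_self]
    have hbdd : BddBelow ((fun k => ‖b + k‖) '' {k : E | T k = 0}) := by
      refine ⟨0, ?_⟩
      rintro _ ⟨k, -, rfl⟩
      exact norm_nonneg _
    refine (csInf_le hbdd ⟨y - b, hk, rfl⟩).trans ?_
    simpa using hyn

/-! ### Countable selection principles -/

/-- If for each `k` the property `P k` holds eventually, then it holds eventually along some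
sequence of parameters tending to infinity. -/
theorem exists_tendsto_atTop_eventually {P : ℕ → ℕ → Prop} (hP : ∀ k, ∀ᶠ n in atTop, P k n) :
    ∃ κ : ℕ → ℕ, Tendsto κ atTop atTop ∧ ∀ᶠ n in atTop, P (κ n) n := by
  classical
  -- Take the largest parameter up to `n` that is valid at `n`. The default value `0` of the search
  -- is harmless because `P 0 n` itself holds eventually.
  refine ⟨fun n => Nat.findGreatest (fun k => P k n) n, ?_, ?_⟩
  · refine tendsto_atTop.2 fun K => ?_
    filter_upwards [hP K, eventually_ge_atTop K] with n hn hKn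
    exact Nat.le_findGreatest hKn hn
  · filter_upwards [hP 0] with n hn
    exact Nat.findGreatest_spec (P := fun k => P k n) (Nat.zero_le n) hn

/-- A separable C*-algebra has a contractive approximate unit that is a sequence. -/
theorem exists_seq_approximateUnit (A : Type*) [NonUnitalCStarAlgebra A]
    [TopologicalSpace.SeparableSpace A] :
    ∃ e : ℕ → A, (∀ k, ‖e k‖ ≤ 1) ∧ (∀ a, Tendsto (fun k => e k * a) atTop (𝓝 a)) ∧
      ∀ a, Tendsto (fun k => a * e k) atTop (𝓝 a) := by
  let _ := CStarAlgebra.spectralOrder A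
  have _ := CStarAlgebra.spectralOrderedRing A
  have hl := CStarAlgebra.increasingApproximateUnit A
  have _ := hl.neBot
  -- The `k`-th term is taken from the canonical approximate unit so as to serve the first `k + 1`
  -- dense elements, on both sides, within `1 / (k + 1)`.
  set d := TopologicalSpace.denseSeq A with hd
  have hdense : DenseRange d := TopologicalSpace.denseRange_denseSeq A
  have key : ∀ k : ℕ, ∃ e : A, ‖e‖ ≤ 1 ∧ ∀ j ∈ Finset.range (k + 1),
      dist (e * d j) (d j) < 1 / ((k : ℝ) + 1) ∧ dist (d j * e) (d j) < 1 / ((k : ℝ) + 1) := by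
    intro k
    have hpos : (0 : ℝ) < 1 / ((k : ℝ) + 1) := by positivity
    have h : ∀ᶠ e in CStarAlgebra.approximateUnit A, ∀ j ∈ Finset.range (k + 1),
        dist (e * d j) (d j) < 1 / ((k : ℝ) + 1) ∧ dist (d j * e) (d j) < 1 / ((k : ℝ) + 1) := by
      rw [Filter.eventually_all_finset]
      intro j _
      exact ((Metric.tendsto_nhds.1 (hl.tendsto_mul_right (d j))) _ hpos).and
        ((Metric.tendsto_nhds.1 (hl.tendsto_mul_left (d j))) _ hpos)
    exact (hl.eventually_norm.and h).exists
  choose e he1 he2 using key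
  -- Passage from the dense sequence to all of `A`, with `T` standing for left or right
  -- multiplication.
  have hlim : ∀ T : A → A → A, (∀ x a b, T x (a - b) = T x a - T x b) →
      (∀ k a, ‖T (e k) a‖ ≤ ‖a‖) →
      (∀ k, ∀ j ∈ Finset.range (k + 1), dist (T (e k) (d j)) (d j) < 1 / ((k : ℝ) + 1)) →
      ∀ a, Tendsto (fun k => T (e k) a) atTop (𝓝 a) := by
    intro T hsub hcontr hclose a
    rw [Metric.tendsto_atTop]
    intro ε hε
    obtain ⟨j, hj⟩ := hdense.exists_dist_lt a (by positivity : 0 < ε / 3)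
    obtain ⟨K, hK⟩ := exists_nat_one_div_lt (by positivity : 0 < ε / 3)
    refine ⟨max j K, fun k hk => ?_⟩
    have h1 : dist (T (e k) a) (T (e k) (d j)) ≤ dist a (d j) := by
      rw [dist_eq_norm, dist_eq_norm, ← hsub]
      exact hcontr _ _
    have h2 := hclose k j (Finset.mem_range.2 (by omega))
    have h3 : 1 / ((k : ℝ) + 1) ≤ 1 / ((K : ℝ) + 1) := by
      have : (K : ℝ) ≤ k := by exact_mod_cast (le_max_right j K).trans hk
      gcongr
    rw [dist_comm] at hj
    calc dist (T (e k) a) a ≤ dist (T (e k) a) (T (e k) (d j)) + dist (T (e k) (d j)) (d j)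
          + dist (d j) a := dist_triangle4 _ _ _ _
      _ < ε := by rw [dist_comm a] at h1; linarith
  refine ⟨e, he1, ?_, ?_⟩
  · exact hlim (fun x a => x * a) (fun x a b => mul_sub x a b)
      (fun k a => (norm_mul_le _ _).trans (mul_le_of_le_one_left (norm_nonneg _) (he1 k)))
      (fun k j hj => (he2 k j hj).1)
  · exact hlim (fun x a => a * x) (fun x a b => sub_mul a b x)
      (fun k a => (norm_mul_le _ _).trans (mul_le_of_le_one_right (norm_nonneg _) (he1 k)))
      (fun k j hj => (he2 k j hj).2)

/-! ### Norms in the sequence algebra -/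

section Norms

variable {A : Type*} [NonUnitalCStarAlgebra A]

theorem piMap_eq_zero_iff {x : LInfty A} :
    piMap A x = 0 ↔ Tendsto (fun n => x n) atTop (𝓝 0) := by
  have h := (cZero A).cls_eq_cls_iff (a := x) (b := 0)
  rw [sub_zero] at h
  exact h

theorem norm_piMap_le (x : LInfty A) : ‖piMap A x‖ ≤ ‖x‖ := (cZero A).norm_cls_le x

theorem eventually_norm_le_of_norm_piMap_lt {x : LInfty A} {δ : ℝ} (h : ‖piMap A x‖ < δ) :
    ∀ᶠ n in atTop, ‖x n‖ ≤ δ := by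
  obtain ⟨y, hy, hyn⟩ := (cZero A).exists_norm_lt (piMap A x)
    (ε := (δ - ‖piMap A x‖) / 2) (by linarith)
  have h0 : Tendsto (fun n => (x - y) n) atTop (𝓝 0) := by
    rw [← piMap_eq_zero_iff, map_sub, sub_eq_zero]
    exact hy.symm
  have h1 : ∀ᶠ n in atTop, ‖(x - y) n‖ < (δ - ‖piMap A x‖) / 2 := by
    have := (tendsto_zero_iff_norm_tendsto_zero.1 h0).eventually_lt_const
      (show 0 < (δ - ‖piMap A x‖) / 2 by linarith)
    exact this
  filter_upwards [h1] with n hn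
  have h2 : x n = (x - y) n + y n := by
    change x n = (x n - y n) + y n
    abel
  have h3 := lp.norm_apply_le_norm ENNReal.top_ne_zero y n
  rw [h2]
  refine (norm_add_le _ _).trans ?_
  linarith

theorem norm_piMap_le_of_eventually {x : LInfty A} {C : ℝ} (hC : 0 ≤ C)
    (h : ∀ᶠ n in atTop, ‖x n‖ ≤ C) : ‖piMap A x‖ ≤ C := by
  obtain ⟨N, hN⟩ := eventually_atTop.1 h
  -- Discarding finitely many terms leaves the class unchanged and makes the bound hold everywhere.
  let y : LInfty A := ⟨fun n => if n < N then 0 else x n, memℓp_infty ⟨C, by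
    rintro _ ⟨n, rfl⟩
    dsimp only
    split_ifs with hn
    · simpa using hC
    · exact hN n (not_lt.1 hn)⟩⟩
  have hyn : ∀ n, y n = if n < N then 0 else x n := fun n => rfl
  have hy : piMap A x = piMap A y := by
    rw [← sub_eq_zero, ← map_sub, piMap_eq_zero_iff]
    refine tendsto_const_nhds.congr' ?_
    filter_upwards [eventually_ge_atTop N] with n hn
    change 0 = x n - y n
    rw [hyn, if_neg (not_lt.2 hn), sub_self]
  rw [hy]
  refine (norm_piMap_le y).trans (lp.norm_le_of_forall_le hC fun n => ?_)
  rw [hyn]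
  split_ifs with hn
  · simpa using hC
  · exact hN n (not_lt.1 hn)

theorem norm_piMap_le_of_forall_eventually {x : LInfty A} {C : ℝ} (hC : 0 ≤ C)
    (h : ∀ δ, C < δ → ∀ᶠ n in atTop, ‖x n‖ ≤ δ) : ‖piMap A x‖ ≤ C :=
  le_of_forall_gt_imp_ge_of_dense fun δ hδ =>
    norm_piMap_le_of_eventually (hC.trans hδ.le) (h δ hδ)

theorem piMap_mem_centralSeq_iff {x : LInfty A} :
    piMap A x ∈ centralSeq A ↔ ∀ a : A, Tendsto (fun n => a * x n - x n * a) atTop (𝓝 0) := by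
  rw [mem_centralSeq]
  refine forall_congr' fun a => ?_
  rw [← sub_eq_zero, constClass, ← map_mul, ← map_mul, ← map_sub, piMap_eq_zero_iff]
  rfl

theorem norm_kappaMap_le (x : centralSeq A) : ‖kappaMap A x‖ ≤ ‖x‖ := (annIdeal A).norm_cls_le x

theorem kappaMap_eq_iff {x y : centralSeq A} :
    kappaMap A x = kappaMap A y ↔ x - y ∈ (annIdeal A).toSubmodule :=
  (annIdeal A).cls_eq_cls_iff

/-- Multiplying by a constant class kills the annihilator, so the first factor may be replaced by a
representative whose norm is close to the quotient norm. -/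
theorem norm_mul_constClass_le (x : centralSeq A) (a : A) :
    ‖(x : SeqAlgebra A) * constClass A a‖ ≤ ‖kappaMap A x‖ * ‖a‖ := by
  have ha : ‖constClass A a‖ ≤ ‖a‖ := (norm_piMap_le _).trans
    (lp.norm_le_of_forall_le (norm_nonneg _) fun _ => le_rfl)
  have key : ∀ ε : ℝ, 0 < ε →
      ‖(x : SeqAlgebra A) * constClass A a‖ ≤ (‖kappaMap A x‖ + ε) * ‖a‖ := by
    intro ε hε
    obtain ⟨y, hy, hyn⟩ := (annIdeal A).exists_norm_lt (kappaMap A x) hε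
    have h : x - y ∈ (annIdeal A).toSubmodule := kappaMap_eq_iff.1 hy.symm
    have h1 : ((x : SeqAlgebra A) - y) * constClass A a = 0 := (h a).1
    rw [sub_mul, sub_eq_zero] at h1
    rw [h1]
    refine (norm_mul_le _ _).trans ?_
    gcongr
    exact hyn.le
  have lim : Tendsto (fun ε : ℝ => (‖kappaMap A x‖ + ε) * ‖a‖) (𝓝[>] 0)
      (𝓝 (‖kappaMap A x‖ * ‖a‖)) := by
    have h : ContinuousAt (fun ε : ℝ => (‖kappaMap A x‖ + ε) * ‖a‖) 0 := by fun_prop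
    have h' := h.tendsto
    simp only [add_zero] at h'
    exact h'.mono_left nhdsWithin_le_nhds
  exact ge_of_tendsto lim (eventually_mem_nhdsWithin.mono fun ε hε => key ε hε)

/-- For separable `A`, the norm of a class in `F_∞(A)` is bounded by the norm of the multiplication
operator that it induces on `A`. -/
theorem norm_kappaMap_le_of_forall_mul [TopologicalSpace.SeparableSpace A] (z : LInfty A)
    (hz : piMap A z ∈ centralSeq A) {C : ℝ} (hC : 0 ≤ C)
    (h : ∀ a : A, ‖a‖ ≤ 1 → ∀ δ, C < δ → ∀ᶠ n in atTop, ‖z n * a‖ ≤ δ) :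
    ‖kappaMap A ⟨piMap A z, hz⟩‖ ≤ C := by
  obtain ⟨e, he1, hel, her⟩ := exists_seq_approximateUnit A
  -- The index `k n` grows slowly enough that `z n * e (k n)` obeys the bound, yet tends to
  -- infinity, so that `e (k n)` still acts as an approximate unit. The sequence `v` then has the
  -- class of `z` in `F_∞(A)` and limiting norm at most `C`.
  obtain ⟨k, hk, hkz⟩ := exists_tendsto_atTop_eventually
    (P := fun k n => ‖z n * e k‖ ≤ C + 1 / ((k : ℝ) + 1))
    (fun k => h (e k) (he1 k) _ (by simp only [lt_add_iff_pos_right]; positivity))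
  let v : LInfty A := ⟨fun n => z n * e (k n), memℓp_infty ⟨‖z‖, by
    rintro _ ⟨n, rfl⟩
    refine (norm_mul_le _ _).trans ((mul_le_of_le_one_right (norm_nonneg _) (he1 _)).trans ?_)
    exact lp.norm_apply_le_norm ENNReal.top_ne_zero z n⟩⟩
  have hv : ∀ n, v n = z n * e (k n) := fun n => rfl
  have hzb : ∀ n, ‖z n‖ ≤ ‖z‖ := lp.norm_apply_le_norm ENNReal.top_ne_zero z
  have hleft : ∀ a : A, Tendsto (fun n => z n * a - v n * a) atTop (𝓝 0) := by
    intro a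
    have h1 : Tendsto (fun n => ‖z‖ * ‖a - e (k n) * a‖) atTop (𝓝 0) := by
      have h2 := (tendsto_const_nhds (x := a)).sub ((hel a).comp hk)
      rw [sub_self] at h2
      simpa using h2.norm.const_mul ‖z‖
    refine squeeze_zero_norm (fun n => ?_) h1
    rw [hv, mul_assoc, ← mul_sub]
    refine (norm_mul_le _ _).trans ?_
    gcongr
    exact hzb n
  have hright : ∀ a : A, Tendsto (fun n => a * z n - a * v n) atTop (𝓝 0) := by
    intro a
    have hc := piMap_mem_centralSeq_iff.1 hz a
    have h1 : Tendsto (fun n => ‖z‖ * ‖a - a * e (k n)‖) atTop (𝓝 0) := by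
      have h2 := (tendsto_const_nhds (x := a)).sub ((her a).comp hk)
      rw [sub_self] at h2
      simpa using h2.norm.const_mul ‖z‖
    have h2 : Tendsto (fun n => 2 * ‖a * z n - z n * a‖ + ‖z‖ * ‖a - a * e (k n)‖) atTop (𝓝 0) := by
      simpa using (hc.norm.const_mul 2).add h1
    refine squeeze_zero_norm (fun n => ?_) h2
    -- Asymptotic centrality of `z` moves `a` to the right of `z n`, next to `e (k n)`, which nearly
    -- fixes it.
    have e1 : a * z n - a * v n = (a * z n - z n * a) - (a * z n - z n * a) * e (k n)
        + z n * (a - a * e (k n)) := by rw [hv]; noncomm_ring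
    rw [e1]
    have b1 : ‖(a * z n - z n * a) * e (k n)‖ ≤ ‖a * z n - z n * a‖ :=
      (norm_mul_le _ _).trans (mul_le_of_le_one_right (norm_nonneg _) (he1 _))
    have b2 : ‖z n * (a - a * e (k n))‖ ≤ ‖z‖ * ‖a - a * e (k n)‖ := by
      refine (norm_mul_le _ _).trans ?_
      gcongr
      exact hzb n
    calc _ ≤ _ := norm_add_le _ _
      _ ≤ _ := add_le_add (norm_sub_le _ _) b2
      _ ≤ _ := by linarith
  have hvc : piMap A v ∈ centralSeq A := by
    rw [piMap_mem_centralSeq_iff]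
    intro a
    -- The commutator of `a` with `v n` is that of `a` with `z n`, corrected by the two differences
    -- just shown to vanish.
    have h1 := ((piMap_mem_centralSeq_iff.1 hz a).sub (hright a)).add (hleft a)
    simp only [sub_zero, add_zero] at h1
    refine h1.congr fun n => ?_
    abel
  have heq : kappaMap A ⟨piMap A z, hz⟩ = kappaMap A ⟨piMap A v, hvc⟩ := by
    rw [kappaMap_eq_iff]
    intro a
    constructor
    · change (piMap A z - piMap A v) * piMap A (constSeq A a) = 0
      rw [← map_sub, ← map_mul, piMap_eq_zero_iff]
      refine (hleft a).congr fun n => ?_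
      rw [← sub_mul]
      rfl
    · change piMap A (constSeq A a) * (piMap A z - piMap A v) = 0
      rw [← map_sub, ← map_mul, piMap_eq_zero_iff]
      refine (hright a).congr fun n => ?_
      rw [← mul_sub]
      rfl
  rw [heq]
  refine (norm_kappaMap_le _).trans ?_
  refine norm_piMap_le_of_forall_eventually hC fun δ hδ => ?_
  have hlim : Tendsto (fun n => C + 1 / ((k n : ℝ) + 1)) atTop (𝓝 C) := by
    have h1 : Tendsto (fun n => 1 / ((k n : ℝ) + 1)) atTop (𝓝 0) :=
      (tendsto_one_div_add_atTop_nhds_zero_nat (𝕜 := ℝ)).comp hk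
    simpa using h1.const_add C
  filter_upwards [hkz, hlim.eventually_le_const hδ] with n hn1 hn2
  exact hn1.trans hn2

end Norms

/-! ### Averaging over the group -/

section Averaging

variable {G : Type*} [TopologicalSpace G] [MeasurableSpace G]

/-- A continuous, compactly supported probability density. -/
structure Density (μ : Measure G) where
  /-- The underlying function. -/
  toFun : G → ℝ
  continuous : Continuous toFun
  hasCompactSupport : HasCompactSupport toFun
  nonneg : ∀ g, 0 ≤ toFun g
  integral_eq_one : ∫ g, toFun g ∂μ = 1

theorem exists_density [Group G] [BorelSpace G] [IsTopologicalGroup G] [LocallyCompactSpace G] (μ : Measure G)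
    [μ.IsHaarMeasure] {U : Set G} (hU : U ∈ 𝓝 (1 : G)) :
    ∃ f : Density μ, ∀ g, f.toFun g ≠ 0 → g ∈ U := by
  -- `G` need not be Hausdorff, so the closure of the identity replaces the point.
  have hd : Disjoint (closure {(1 : G)}) (interior U)ᶜ := by
    rw [Set.disjoint_compl_right_iff_subset]
    exact isCompact_singleton.closure_subset_of_isOpen isOpen_interior
      (Set.singleton_subset_iff.2 (mem_interior_iff_mem_nhds.2 hU))
  obtain ⟨f, f1, f0, fc, fI⟩ := exists_continuous_one_zero_of_isCompact
    isCompact_singleton.closure isOpen_interior.isClosed_compl hd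
  have hf1 : f 1 = 1 := f1 (subset_closure rfl)
  have hpos : 0 < ∫ g, f g ∂μ :=
    f.continuous.integral_pos_of_hasCompactSupport_nonneg_nonzero fc (fun g => (fI g).1)
      (x := 1) (by rw [hf1]; exact one_ne_zero)
  refine ⟨⟨fun g => (∫ g, f g ∂μ)⁻¹ * f g, continuous_const.mul f.continuous, fc.mul_left,
    fun g => mul_nonneg (inv_nonneg.2 hpos.le) (fI g).1, ?_⟩, fun g hg => ?_⟩
  · rw [integral_const_mul, inv_mul_cancel₀ hpos.ne']
  · by_contra hgU
    refine hg ?_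
    have : f g = 0 := f0 fun h => hgU (interior_subset h)
    simp only [this, mul_zero]

namespace Density

variable {μ : Measure G} (f : Density μ)
variable {E : Type*} [NormedAddCommGroup E] [NormedSpace ℝ E]

theorem integral_smul_const [CompleteSpace E] (a : E) : ∫ g, f.toFun g • a ∂μ = a := by
  rw [_root_.integral_smul_const, f.integral_eq_one, one_smul]

theorem norm_integral_smul_le (u : G → E) :
    ‖∫ g, f.toFun g • u g ∂μ‖ ≤ ∫ g, f.toFun g * ‖u g‖ ∂μ := by
  refine (norm_integral_le_integral_norm _).trans (le_of_eq ?_)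
  refine integral_congr_ae (Eventually.of_forall fun g => ?_)
  simp only [norm_smul, Real.norm_eq_abs, abs_of_nonneg (f.nonneg g)]

variable [BorelSpace G] [IsFiniteMeasureOnCompacts μ]

theorem integrable_smul {u : G → E} (hu : Continuous u) :
    Integrable (fun g => f.toFun g • u g) μ :=
  (f.continuous.smul hu).integrable_of_hasCompactSupport f.hasCompactSupport.smul_right

theorem integrable : Integrable f.toFun μ :=
  f.continuous.integrable_of_hasCompactSupport f.hasCompactSupport

theorem norm_integral_smul_le_of_forall {u : G → E} (hu : Continuous u) {C : ℝ}
    (hC : ∀ g, ‖u g‖ ≤ C) : ‖∫ g, f.toFun g • u g ∂μ‖ ≤ C := by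
  refine (f.norm_integral_smul_le u).trans ?_
  calc ∫ g, f.toFun g * ‖u g‖ ∂μ ≤ ∫ g, f.toFun g * C ∂μ :=
        integral_mono (f.integrable_smul hu.norm) (f.integrable_smul continuous_const)
          fun g => mul_le_mul_of_nonneg_left (hC g) (f.nonneg g)
    _ = C := by rw [integral_mul_const, f.integral_eq_one, one_mul]

/-- Averages of a bounded sequence of functions are eventually small if the functions are
eventually small at each point of the support of the density. -/
theorem eventually_norm_integral_smul_le {u : ℕ → G → E} (hu : ∀ n, Continuous (u n)) {C : ℝ}
    (hC : ∀ n g, ‖u n g‖ ≤ C) {ε : ℝ}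
    (h : ∀ g, f.toFun g ≠ 0 → ∀ δ, ε < δ → ∀ᶠ n in atTop, ‖u n g‖ ≤ δ) {δ : ℝ} (hδ : ε < δ) :
    ∀ᶠ n in atTop, ‖∫ g, f.toFun g • u n g ∂μ‖ ≤ δ := by
  -- The excess over `ε` tends to zero pointwise on the support, though not uniformly in `g`;
  -- dominated convergence makes its average vanish. The dominating constant uses `|ε|` because `ε`
  -- has no assumed sign.
  have hcont : ∀ n, Continuous fun g => max (‖u n g‖ - ε) 0 := fun n =>
    ((hu n).norm.sub continuous_const).max continuous_const
  have hlim : Tendsto (fun n => ∫ g, f.toFun g • max (‖u n g‖ - ε) 0 ∂μ) atTop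
      (𝓝 (∫ _, (0 : ℝ) ∂μ)) := by
    refine tendsto_integral_of_dominated_convergence (fun g => f.toFun g • (C + |ε|))
      (fun n => (f.integrable_smul (hcont n)).aestronglyMeasurable)
      (f.integrable_smul continuous_const) (fun n => Eventually.of_forall fun g => ?_)
      (Eventually.of_forall fun g => ?_)
    · have h0 : 0 ≤ max (‖u n g‖ - ε) 0 := le_max_right _ _
      rw [smul_eq_mul, Real.norm_eq_abs, abs_of_nonneg (mul_nonneg (f.nonneg g) h0), smul_eq_mul]
      refine mul_le_mul_of_nonneg_left (max_le ?_ ?_) (f.nonneg g)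
      · have := hC n g
        have := neg_abs_le ε
        linarith
      · have := (norm_nonneg _).trans (hC n g)
        positivity
    · by_cases hg : f.toFun g = 0
      · simp [hg]
      · have h1 : Tendsto (fun n => max (‖u n g‖ - ε) 0) atTop (𝓝 0) := by
          rw [Metric.tendsto_nhds]
          intro η hη
          filter_upwards [h g hg (ε + η / 2) (by linarith)] with n hn
          rw [Real.dist_0_eq_abs, abs_of_nonneg (le_max_right _ _)]
          exact max_lt (by linarith) hη
        simpa using h1.const_mul (f.toFun g)
  rw [integral_zero] at hlim
  filter_upwards [hlim.eventually_le_const (sub_pos.2 hδ)] with n hn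
  refine (f.norm_integral_smul_le (u n)).trans ?_
  calc ∫ g, f.toFun g * ‖u n g‖ ∂μ
      ≤ ∫ g, (f.toFun g • max (‖u n g‖ - ε) 0 + f.toFun g • ε) ∂μ := by
        refine integral_mono (f.integrable_smul (hu n).norm)
          ((f.integrable_smul (hcont n)).add (f.integrable_smul continuous_const)) fun g => ?_
        simp only [smul_eq_mul, ← mul_add]
        refine mul_le_mul_of_nonneg_left ?_ (f.nonneg g)
        have := le_max_left (‖u n g‖ - ε) 0
        linarith
    _ = (∫ g, f.toFun g • max (‖u n g‖ - ε) 0 ∂μ) + ε := by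
        rw [integral_add (f.integrable_smul (hcont n)) (f.integrable_smul continuous_const),
          f.integral_smul_const]
    _ ≤ δ := by linarith

end Density

variable [Group G] [BorelSpace G]
variable {A : Type*} [NonUnitalCStarAlgebra A] {α : G →* (A ≃⋆ₐ[ℂ] A)}
variable {μ : Measure G} [IsFiniteMeasureOnCompacts μ]

/-- The termwise average of a bounded sequence along the orbits of the action. -/
noncomputable def average (hα : IsContinuousAction α) (f : Density μ) (x : LInfty A) : LInfty A :=
  ⟨fun n => ∫ g, f.toFun g • α g (x n) ∂μ, memℓp_infty ⟨‖x‖, by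
    rintro _ ⟨n, rfl⟩
    refine f.norm_integral_smul_le_of_forall (hα (x n)) fun g => ?_
    rw [StarAlgEquiv.norm_map]
    exact lp.norm_apply_le_norm ENNReal.top_ne_zero x n⟩⟩

variable (hα : IsContinuousAction α) (f : Density μ)

theorem average_apply (x : LInfty A) (n : ℕ) :
    average hα f x n = ∫ g, f.toFun g • α g (x n) ∂μ := rfl

theorem norm_average_le (x : LInfty A) : ‖average hα f x‖ ≤ ‖x‖ := by
  refine lp.norm_le_of_forall_le (norm_nonneg x) fun n => ?_
  refine f.norm_integral_smul_le_of_forall (hα (x n)) fun g => ?_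
  rw [StarAlgEquiv.norm_map]
  exact lp.norm_apply_le_norm ENNReal.top_ne_zero x n

theorem map_average (L : A →L[ℂ] A) (x : LInfty A) (n : ℕ) :
    L (average hα f x n) = ∫ g, f.toFun g • L (α g (x n)) ∂μ := by
  rw [average_apply, ← L.integral_comp_comm (f.integrable_smul (hα (x n)))]
  refine integral_congr_ae (Eventually.of_forall fun g => ?_)
  simp only [← Complex.coe_smul, map_smul]

/-- A bounded operator `L` commutes with the integral, so asymptotic estimates along orbits survive
averaging. This is applied with `L` a commutator. -/
theorem eventually_norm_map_average_le (L : A →L[ℂ] A) (x : LInfty A) {ε : ℝ}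
    (h : ∀ g, f.toFun g ≠ 0 → ∀ δ, ε < δ → ∀ᶠ n in atTop, ‖L (α g (x n))‖ ≤ δ) {δ : ℝ}
    (hδ : ε < δ) : ∀ᶠ n in atTop, ‖L (average hα f x n)‖ ≤ δ := by
  simp only [map_average]
  refine f.eventually_norm_integral_smul_le (fun n => L.continuous.comp (hα (x n)))
    (C := ‖L‖ * ‖x‖) (fun n g => ?_) h hδ
  refine L.le_opNorm_of_le ?_
  rw [StarAlgEquiv.norm_map]
  exact lp.norm_apply_le_norm ENNReal.top_ne_zero x n

theorem eventually_norm_map_average_sub_le (L : A →L[ℂ] A) (x : LInfty A) {ε : ℝ}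
    (h : ∀ g, f.toFun g ≠ 0 → ∀ δ, ε < δ → ∀ᶠ n in atTop, ‖L (α g (x n) - x n)‖ ≤ δ) {δ : ℝ}
    (hδ : ε < δ) : ∀ᶠ n in atTop, ‖L (average hα f x n - x n)‖ ≤ δ := by
  have hc : ∀ n, Continuous fun g => L (α g (x n) - x n) := fun n =>
    L.continuous.comp ((hα (x n)).sub continuous_const)
  -- The density has integral one, so `x n` is its own average and the subtraction moves under the
  -- integral.
  have e : ∀ n, L (average hα f x n - x n) = ∫ g, f.toFun g • L (α g (x n) - x n) ∂μ := by
    intro n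
    simp only [map_sub, smul_sub]
    have h1 : Integrable (fun g => f.toFun g • L (α g (x n))) μ :=
      f.integrable_smul (L.continuous.comp (hα (x n)))
    rw [integral_sub h1 (f.integrable_smul continuous_const), f.integral_smul_const, map_average]
  simp only [e]
  refine f.eventually_norm_integral_smul_le hc (C := ‖L‖ * (‖x‖ + ‖x‖)) (fun n g => ?_) h hδ
  have hx := lp.norm_apply_le_norm ENNReal.top_ne_zero x n
  refine L.le_opNorm_of_le ((norm_sub_le _ _).trans (add_le_add ?_ hx))
  rwa [StarAlgEquiv.norm_map]

end Averaging

/-! ### Continuity of the orbit of an averaged sequence -/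

section AveragingContinuity

open scoped Pointwise

variable {G : Type*} [Group G] [TopologicalSpace G] [IsTopologicalGroup G] [LocallyCompactSpace G]
  [MeasurableSpace G] [BorelSpace G] {A : Type*} [NonUnitalCStarAlgebra A] {α : G →* (A ≃⋆ₐ[ℂ] A)}
  {μ : Measure G} [μ.IsHaarMeasure]

theorem average_mem_continuousPart (hα : IsContinuousAction α) (f : Density μ) (x : LInfty A) :
    average hα f x ∈ continuousPart (linftyAction α) := by
  have htrans : ∀ h n, α h (average hα f x n) =
      ∫ g, f.toFun (h⁻¹ * g) • α g (x n) ∂μ := by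
    intro h n
    let L : A →L[ℂ] A := ⟨(α h : A →ₗ[ℂ] A), (StarAlgEquiv.isometry (α h)).continuous⟩
    have h1 := map_average hα f L x n
    -- Left invariance of Haar measure transfers the action of `h` from the sequence to the density.
    rw [← integral_mul_left_eq_self _ h⁻¹] at h1
    refine h1.trans (integral_congr_ae (Eventually.of_forall fun g => ?_))
    change f.toFun (h⁻¹ * g) • (α h * α (h⁻¹ * g)) (x n) = _
    rw [← map_mul, mul_inv_cancel_left]
  have hint : ∀ h n, Integrable (fun g => f.toFun (h⁻¹ * g) • α g (x n)) μ := by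
    intro h n
    refine Continuous.integrable_of_hasCompactSupport
      ((f.continuous.comp (continuous_const_mul _)).smul (hα (x n))) ?_
    exact (f.hasCompactSupport.comp_homeomorph (Homeomorph.mulLeft h⁻¹)).smul_right
  have hint' : ∀ h h' : G, Integrable (fun g => |f.toFun (h⁻¹ * g) - f.toFun (h'⁻¹ * g)|) μ := by
    intro h h'
    have : ∀ h : G, Integrable (fun g => f.toFun (h⁻¹ * g)) μ := fun h =>
      f.integrable.comp_mul_left h⁻¹
    exact ((this h).sub (this h')).abs
  change Continuous fun h => linftyAction α h (average hα f x)
  rw [continuous_iff_continuousAt]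
  intro h₀
  rw [ContinuousAt, tendsto_iff_norm_sub_tendsto_zero]
  -- The `L¹` distance between translates of `f` does not involve `n`; this turns pointwise
  -- continuity into continuity in the supremum norm.
  have hbound : ∀ h, ‖linftyAction α h (average hα f x) - linftyAction α h₀ (average hα f x)‖ ≤
      (∫ g, |f.toFun (h⁻¹ * g) - f.toFun (h₀⁻¹ * g)| ∂μ) * ‖x‖ := by
    intro h
    refine lp.norm_le_of_forall_le (by positivity) fun n => ?_
    change ‖α h (average hα f x n) - α h₀ (average hα f x n)‖ ≤ _
    rw [htrans, htrans, ← integral_sub (hint _ _) (hint _ _), ← integral_mul_const]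
    refine norm_integral_le_of_norm_le ((hint' _ _).mul_const _)
      (Eventually.of_forall fun g => ?_)
    rw [← sub_smul, norm_smul, StarAlgEquiv.norm_map, Real.norm_eq_abs]
    gcongr
    exact lp.norm_apply_le_norm ENNReal.top_ne_zero x n
  refine squeeze_zero (fun h => norm_nonneg _) hbound ?_
  obtain ⟨K, hK, hKn⟩ := exists_compact_mem_nhds h₀
  -- For `h` in a compact neighbourhood `K` of `h₀`, all translates of `f` are supported in the
  -- compact set `K * tsupport f.toFun`.
  have hco : ContinuousOn
      (fun h => ∫ g, |f.toFun (h⁻¹ * g) - f.toFun (h₀⁻¹ * g)| ∂μ) K := by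
    refine continuousOn_integral_of_compact_support
      (k := K * tsupport f.toFun) (hK.mul f.hasCompactSupport.isCompact) ?_ ?_
    · refine Continuous.continuousOn ?_
      have := f.continuous
      simp only [Function.uncurry_def]
      fun_prop
    · intro p g hp hg
      have : ∀ p ∈ K, f.toFun (p⁻¹ * g) = 0 := fun p hp => by
        by_contra hne
        exact hg ⟨p, hp, p⁻¹ * g, subset_tsupport _ hne, mul_inv_cancel_left p g⟩
      rw [this p hp, this h₀ (mem_of_mem_nhds hKn), sub_zero, abs_zero]
  have hlim := ((hco.continuousAt hKn).tendsto).mul_const ‖x‖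
  simpa using hlim

end AveragingContinuity

/-! ### Lifting continuous elements -/

section Lifting

theorem isClosed_continuousPart {G : Type*} [Group G] [TopologicalSpace G]
    {B : Type*} [NonUnitalNormedRing B] [StarRing B] [NormedSpace ℂ B] [NormedStarGroup B]
    (β : G →* (B ≃⋆ₐ[ℂ] B)) (hβ : ∀ g b, ‖β g b‖ ≤ ‖b‖) :
    IsClosed (continuousPart β : Set B) := by
  refine isClosed_of_closure_subset fun b hb => ?_
  change Continuous fun g => β g b
  refine continuous_of_uniform_approx_of_continuous fun u hu => ?_
  obtain ⟨ε, hε, hεu⟩ := Metric.mem_uniformity_dist.1 hu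
  obtain ⟨c, hc, hbc⟩ := Metric.mem_closure_iff.1 hb ε hε
  refine ⟨fun g => β g c, hc, fun g => hεu ?_⟩
  rw [dist_eq_norm, ← map_sub]
  exact (hβ g _).trans_lt (by rwa [← dist_eq_norm])

theorem eventually_norm_sub_lt {G : Type*} [Group G] [TopologicalSpace G]
    {B : Type*} [NonUnitalNormedRing B] [StarRing B] [NormedSpace ℂ B] [NormedStarGroup B]
    {β : G →* (B ≃⋆ₐ[ℂ] B)} {b : B} (hb : b ∈ continuousPart β) {δ : ℝ} (hδ : 0 < δ) :
    ∀ᶠ g in 𝓝 (1 : G), ‖β g b - b‖ < δ := by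
  have hb' : Continuous fun g => β g b := hb
  have h : Continuous fun g => ‖β g b - b‖ := (hb'.sub continuous_const).norm
  exact (h.tendsto' 1 0 (by simp)).eventually_lt_const hδ

theorem isEquivariantQuotientMap_of_lift {G : Type*} [Group G]
    {B : Type*} [NonUnitalNormedRing B] [StarRing B] [NormedSpace ℂ B]
    {C : Type*} [NonUnitalNormedRing C] [StarRing C] [NormedSpace ℂ C]
    {β : G →* (B ≃⋆ₐ[ℂ] B)} {γ : G →* (C ≃⋆ₐ[ℂ] C)} {φ : B →⋆ₙₐ[ℂ] C}
    (hequiv : ∀ g b, φ (β g b) = γ g (φ b)) (hφ : ∀ b, ‖φ b‖ ≤ ‖b‖)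
    (hlift : ∀ (z : C) (ε : ℝ), 0 < ε → ∃ y, φ y = z ∧ ‖y‖ ≤ ‖z‖ + ε) :
    IsEquivariantQuotientMap β γ φ :=
  ⟨hequiv, fun z => (hlift z 1 one_pos).imp fun _ h => h.1,
    norm_eq_sInf_of_lift (φ : B →+ C) hφ hlift⟩

variable {G : Type*} [Group G] {A : Type*} [NonUnitalCStarAlgebra A] {α : G →* (A ≃⋆ₐ[ℂ] A)}

theorem norm_linftyAction_le (g : G) (x : LInfty A) : ‖linftyAction α g x‖ ≤ ‖x‖ := by
  refine lp.norm_le_of_forall_le (norm_nonneg x) fun n => ?_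
  change ‖α g (x n)‖ ≤ _
  rw [StarAlgEquiv.norm_map]
  exact lp.norm_apply_le_norm ENNReal.top_ne_zero x n

theorem fAction_kappaMap (g : G) (x : centralSeq A) :
    fAction α g (kappaMap A x) = kappaMap A (centralAction α g x) := rfl

variable [TopologicalSpace G]

theorem piMap_mem_continuousPart {x : LInfty A} (hx : x ∈ continuousPart (linftyAction α)) :
    piMap A x ∈ continuousPart (seqAction α) := by
  have hx' : Continuous fun g => linftyAction α g x := hx
  change Continuous fun g => piMap A (linftyAction α g x)
  exact (AddMonoidHomClass.continuous_of_bound (piMap A) 1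
    fun x => by simpa using norm_piMap_le x).comp hx'

theorem kappaMap_mem_continuousPart {x : centralSeq A} (hx : x ∈ centralContinuousPart α) :
    kappaMap A x ∈ continuousPart (fAction α) := by
  have hx' : Continuous fun g => seqAction α g (x : SeqAlgebra A) := hx
  change Continuous fun g => kappaMap A (centralAction α g x)
  exact (AddMonoidHomClass.continuous_of_bound (kappaMap A) 1
    fun x => by simpa using norm_kappaMap_le x).comp (Continuous.subtype_mk hx' _)

theorem completeSpace_of_isClosed {B : Type*} [NonUnitalNormedRing B] [StarRing B]
    [NormedSpace ℂ B] [CompleteSpace B] (S : NonUnitalStarSubalgebra ℂ B)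
    (hS : IsClosed (S : Set B)) : CompleteSpace S :=
  hS.completeSpace_coe

instance completeSpace_continuousPart_linftyAction :
    CompleteSpace (continuousPart (linftyAction α)) :=
  completeSpace_of_isClosed _ (isClosed_continuousPart _ norm_linftyAction_le)

theorem isClosed_centralSeq : IsClosed (centralSeq A : Set (SeqAlgebra A)) := by
  have h : (centralSeq A : Set (SeqAlgebra A)) =
      ⋂ a : A, {x | constClass A a * x = x * constClass A a} := by
    ext x
    rw [Set.mem_iInter]
    exact mem_centralSeq A
  rw [h]
  exact isClosed_iInter fun a => isClosed_eq (continuous_const_mul _) (continuous_mul_const _)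

variable (α) in
/-- The bounded sequences with continuous orbit map that are asymptotically central. -/
noncomputable def asympCentralPart : NonUnitalStarSubalgebra ℂ (LInfty A) :=
  continuousPart (linftyAction α) ⊓ (centralSeq A).comap (piMap A)

theorem isClosed_asympCentralPart : IsClosed (asympCentralPart α : Set (LInfty A)) := by
  have hcont : Continuous (piMap A) := AddMonoidHomClass.continuous_of_bound (piMap A) 1
    fun x => by simpa using norm_piMap_le x
  have h : (asympCentralPart α : Set (LInfty A)) =
      (continuousPart (linftyAction α) : Set (LInfty A)) ∩
        piMap A ⁻¹' (centralSeq A : Set (SeqAlgebra A)) := Set.ext fun _ => Iff.rfl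
  rw [h]
  exact IsClosed.inter (isClosed_continuousPart _ norm_linftyAction_le)
    (isClosed_centralSeq.preimage hcont)

instance completeSpace_asympCentralPart : CompleteSpace (asympCentralPart α) :=
  completeSpace_of_isClosed _ isClosed_asympCentralPart

variable (α) in
/-- The map induced by `π_A` from asymptotically central sequences to `A_{∞,α} ∩ A'`. -/
noncomputable def piCentral : asympCentralPart α →+ centralContinuousPart α where
  toFun y := ⟨⟨piMap A y, y.2.2⟩, piMap_mem_continuousPart y.2.1⟩
  map_zero' := Subtype.ext (Subtype.ext (map_zero (piMap A)))
  map_add' x y := Subtype.ext (Subtype.ext (map_add (piMap A) (x : LInfty A) y))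

variable (α) in
/-- The map induced by `κ_A` from `A_{∞,α} ∩ A'` to the continuous part of `F_∞(A)`. -/
noncomputable def kappaContinuous : centralContinuousPart α →+ continuousPart (fAction α) where
  toFun w := ⟨kappaMap A w, kappaMap_mem_continuousPart w.2⟩
  map_zero' := Subtype.ext (map_zero (kappaMap A))
  map_add' x y := Subtype.ext (map_add (kappaMap A) (x : centralSeq A) y)

theorem norm_piCentral_le (y : asympCentralPart α) : ‖piCentral α y‖ ≤ ‖y‖ :=
  norm_piMap_le (y : LInfty A)

theorem norm_kappaContinuous_le (w : centralContinuousPart α) : ‖kappaContinuous α w‖ ≤ ‖w‖ :=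
  norm_kappaMap_le (w : centralSeq A)

/-- Each translate of an asymptotically central sequence is again asymptotically central, and taking
the commutator with a fixed `a` is a bounded operator, so averaging preserves the property. -/
theorem piMap_average_mem_centralSeq (hα : IsContinuousAction α) [MeasurableSpace G] [BorelSpace G]
    {μ : Measure G} [IsFiniteMeasureOnCompacts μ] (f : Density μ) {x : LInfty A}
    (hx : piMap A x ∈ centralSeq A) : piMap A (average hα f x) ∈ centralSeq A := by
  rw [piMap_mem_centralSeq_iff]
  intro a
  rw [Metric.tendsto_nhds]
  intro ε hε
  let L : A →L[ℂ] A := ContinuousLinearMap.mul ℂ A a - (ContinuousLinearMap.mul ℂ A).flip a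
  have h := eventually_norm_map_average_le hα f L x (ε := 0) (fun g _ δ hδ => ?_) (half_pos hε)
  · filter_upwards [h] with n hn
    rw [dist_zero_right]
    exact lt_of_le_of_lt hn (half_lt_self hε)
  · have hg : piMap A (linftyAction α g x) ∈ centralSeq A := seqAction_mem_centralSeq α g _ hx
    have h1 := (tendsto_zero_iff_norm_tendsto_zero.1 (piMap_mem_centralSeq_iff.1 hg a))
    exact h1.eventually_le_const hδ

variable [IsTopologicalGroup G] [LocallyCompactSpace G]

/-- The lift is the average of a nearly norm-minimal representative, against a density supported
where `z` moves by less than `δ`. -/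
theorem exists_approx_lift_piMap (hα : IsContinuousAction α) {z : SeqAlgebra A}
    (hz : z ∈ continuousPart (seqAction α)) {δ : ℝ} (hδ : 0 < δ) :
    ∃ y ∈ continuousPart (linftyAction α), ‖y‖ ≤ ‖z‖ + δ ∧ ‖z - piMap A y‖ ≤ δ := by
  let _ : MeasurableSpace G := borel G
  have _ : BorelSpace G := ⟨rfl⟩
  obtain ⟨x, rfl, hx⟩ := (cZero A).exists_norm_lt z hδ
  change piMap A x ∈ _ at hz
  change ∃ y ∈ continuousPart (linftyAction α), ‖y‖ ≤ ‖piMap A x‖ + δ ∧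
    ‖piMap A x - piMap A y‖ ≤ δ
  have hU := eventually_norm_sub_lt hz hδ
  obtain ⟨f, hf⟩ := exists_density (Measure.haar : Measure G) hU
  refine ⟨average hα f x, average_mem_continuousPart hα f x,
    (norm_average_le hα f x).trans hx.le, ?_⟩
  rw [norm_sub_rev, ← map_sub]
  refine norm_piMap_le_of_forall_eventually hδ.le fun η hη => ?_
  refine eventually_norm_map_average_sub_le hα f (ContinuousLinearMap.id ℂ A) x
    (fun g hg η hη => ?_) hη
  have h1 : ‖piMap A (linftyAction α g x - x)‖ < δ := by
    rw [map_sub]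
    exact hf g hg
  exact eventually_norm_le_of_norm_piMap_lt (h1.trans hη)

theorem exists_approx_lift_kappaMap [TopologicalSpace.SeparableSpace A]
    (hα : IsContinuousAction α) {z : FAlgebra A} (hz : z ∈ continuousPart (fAction α)) {δ : ℝ}
    (hδ : 0 < δ) :
    ∃ y ∈ continuousPart (linftyAction α), ∃ hy : piMap A y ∈ centralSeq A,
      ‖y‖ ≤ ‖z‖ + δ ∧ ‖z - kappaMap A ⟨piMap A y, hy⟩‖ ≤ δ := by
  let _ : MeasurableSpace G := borel G
  have _ : BorelSpace G := ⟨rfl⟩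
  -- Two quotients are unwound, from `F_∞(A)` to `A_∞` and then to sequences, each costing `δ / 2`
  -- in norm.
  obtain ⟨⟨w, hw⟩, rfl, hwn⟩ := (annIdeal A).exists_norm_lt z (half_pos hδ)
  obtain ⟨x, rfl, hx⟩ := (cZero A).exists_norm_lt w (half_pos hδ)
  change piMap A x ∈ _ at hw
  change kappaMap A ⟨piMap A x, hw⟩ ∈ _ at hz
  change ‖piMap A x‖ < ‖kappaMap A ⟨piMap A x, hw⟩‖ + δ / 2 at hwn
  change ‖x‖ < ‖piMap A x‖ + δ / 2 at hx
  change ∃ y ∈ continuousPart (linftyAction α), ∃ hy : piMap A y ∈ centralSeq A,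
    ‖y‖ ≤ ‖kappaMap A ⟨piMap A x, hw⟩‖ + δ ∧
      ‖kappaMap A ⟨piMap A x, hw⟩ - kappaMap A ⟨piMap A y, hy⟩‖ ≤ δ
  set z := kappaMap A ⟨piMap A x, hw⟩ with hzdef
  have hU := eventually_norm_sub_lt hz hδ
  obtain ⟨f, hf⟩ := exists_density (Measure.haar : Measure G) hU
  have hy := piMap_average_mem_centralSeq hα f hw
  refine ⟨average hα f x, average_mem_continuousPart hα f x, hy,
    (norm_average_le hα f x).trans (by linarith), ?_⟩
  have hdiff : piMap A (average hα f x - x) ∈ centralSeq A := by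
    rw [map_sub]
    exact sub_mem hy hw
  have heq : kappaMap A ⟨piMap A (average hα f x), hy⟩ - z =
      kappaMap A ⟨piMap A (average hα f x - x), hdiff⟩ := by
    rw [hzdef, ← map_sub]
    rfl
  rw [norm_sub_rev, heq]
  -- Continuity is known only modulo the annihilator, so the error is measured through right
  -- multiplication by `a`, where `norm_mul_constClass_le` applies.
  refine norm_kappaMap_le_of_forall_mul _ hdiff hδ.le fun a ha η hη => ?_
  refine eventually_norm_map_average_sub_le hα f ((ContinuousLinearMap.mul ℂ A).flip a) x
    (fun g hg η hη => ?_) hη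
  have h1 : ‖piMap A ((linftyAction α g x - x) * constSeq A a)‖ < η := by
    have h2 := norm_mul_constClass_le (centralAction α g ⟨piMap A x, hw⟩ - ⟨piMap A x, hw⟩) a
    rw [map_sub, ← fAction_kappaMap, ← hzdef] at h2
    refine lt_of_le_of_lt h2 (lt_of_le_of_lt ?_ ((show ‖fAction α g z - z‖ < δ from hf g hg).trans hη))
    exact mul_le_of_le_one_right (norm_nonneg _) ha
  exact eventually_norm_le_of_norm_piMap_lt h1

theorem exists_lift_piMap (hα : IsContinuousAction α) {z : SeqAlgebra A}
    (hz : z ∈ continuousPart (seqAction α)) {ε : ℝ} (hε : 0 < ε) :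
    ∃ y ∈ continuousPart (linftyAction α), piMap A y = z ∧ ‖y‖ ≤ ‖z‖ + ε := by
  let T : continuousPart (linftyAction α) →+ continuousPart (seqAction α) :=
    { toFun := fun y => ⟨piMap A y, piMap_mem_continuousPart y.2⟩
      map_zero' := Subtype.ext (map_zero (piMap A))
      map_add' := fun x y => Subtype.ext (map_add (piMap A) (x : LInfty A) y) }
  obtain ⟨y, hy, hyn⟩ := exists_lift_of_approx T (fun y => norm_piMap_le (y : LInfty A))
    (fun z δ hδ => by
      obtain ⟨y, hy, h1, h2⟩ := exists_approx_lift_piMap hα z.2 hδ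
      exact ⟨⟨y, hy⟩, h1, h2⟩) ⟨z, hz⟩ hε
  exact ⟨y, y.2, congrArg Subtype.val hy, hyn⟩

/-- The corrections are summed among asymptotically central sequences with continuous orbit, a
closed and hence complete subspace of the bounded sequences. Lifting along the composite map all the
way to sequences avoids any appeal to completeness of the quotients. -/
theorem exists_lift_kappaMap [TopologicalSpace.SeparableSpace A] (hα : IsContinuousAction α)
    {z : FAlgebra A} (hz : z ∈ continuousPart (fAction α)) {ε : ℝ} (hε : 0 < ε) :
    ∃ w ∈ centralContinuousPart α, kappaMap A w = z ∧ ‖w‖ ≤ ‖z‖ + ε := by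
  have happ : ∀ (z : continuousPart (fAction α)) (δ : ℝ), 0 < δ →
      ∃ y : asympCentralPart α, ‖y‖ ≤ ‖z‖ + δ ∧
        ‖z - (kappaContinuous α).comp (piCentral α) y‖ ≤ δ := by
    intro z δ hδ
    obtain ⟨y, hy, hyc, h1, h2⟩ := exists_approx_lift_kappaMap hα z.2 hδ
    exact ⟨⟨y, hy, hyc⟩, h1, h2⟩
  obtain ⟨y, hy, hyn⟩ := exists_lift_of_approx ((kappaContinuous α).comp (piCentral α))
    (fun y => (norm_kappaContinuous_le _).trans (norm_piCentral_le y)) happ ⟨z, hz⟩ hε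
  exact ⟨piCentral α y, (piCentral α y).2, congrArg Subtype.val hy,
    (norm_piCentral_le y).trans hyn⟩

end Lifting

end SeqAlg

/-! ### The two equivariant quotient maps -/

theorem mainTheorem3 {G : Type*} [Group G] [TopologicalSpace G] [IsTopologicalGroup G]
    [LocallyCompactSpace G] {A : Type*} [NonUnitalCStarAlgebra A]
    (α : G →* (A ≃⋆ₐ[ℂ] A)) (hα : SeqAlg.IsContinuousAction α) :
    ((SeqAlg.piMap A '' (SeqAlg.continuousPart (SeqAlg.linftyAction α) : Set (SeqAlg.LInfty A)) =
        (SeqAlg.continuousPart (SeqAlg.seqAction α) : Set (SeqAlg.SeqAlgebra A))) ∧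
      ∃ φ : SeqAlg.continuousPart (SeqAlg.linftyAction α) →⋆ₙₐ[ℂ]
          SeqAlg.continuousPart (SeqAlg.seqAction α),
        (∀ x, (φ x : SeqAlg.SeqAlgebra A) = SeqAlg.piMap A (x : SeqAlg.LInfty A)) ∧
        SeqAlg.IsEquivariantQuotientMap
          (SeqAlg.continuousPartAction (SeqAlg.linftyAction α))
          (SeqAlg.continuousPartAction (SeqAlg.seqAction α)) φ) ∧
    (TopologicalSpace.SeparableSpace A →
      (SeqAlg.kappaMap A '' (SeqAlg.centralContinuousPart α : Set (SeqAlg.centralSeq A)) =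
        (SeqAlg.continuousPart (SeqAlg.fAction α) : Set (SeqAlg.FAlgebra A))) ∧
      ∃ ψ : SeqAlg.centralContinuousPart α →⋆ₙₐ[ℂ] SeqAlg.continuousPart (SeqAlg.fAction α),
        (∀ x, (ψ x : SeqAlg.FAlgebra A) = SeqAlg.kappaMap A (x : SeqAlg.centralSeq A)) ∧
        SeqAlg.IsEquivariantQuotientMap
          (SeqAlg.centralContinuousAction α)
          (SeqAlg.continuousPartAction (SeqAlg.fAction α)) ψ) := by
  refine ⟨⟨?_, ?_⟩, fun hsep => ⟨?_, ?_⟩⟩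
  · refine Set.Subset.antisymm ?_ fun z hz => ?_
    · rintro _ ⟨x, hx, rfl⟩
      exact SeqAlg.piMap_mem_continuousPart hx
    · obtain ⟨y, hy, hyz, -⟩ := SeqAlg.exists_lift_piMap hα hz one_pos
      exact ⟨y, hy, hyz⟩
  · let φ : SeqAlg.continuousPart (SeqAlg.linftyAction α) →⋆ₙₐ[ℂ]
        SeqAlg.continuousPart (SeqAlg.seqAction α) :=
      NonUnitalStarAlgHom.codRestrict ((SeqAlg.piMap A).comp
        (NonUnitalStarSubalgebraClass.subtype (SeqAlg.continuousPart (SeqAlg.linftyAction α)))) _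
        fun x => SeqAlg.piMap_mem_continuousPart x.2
    have hlift : ∀ (z : SeqAlg.continuousPart (SeqAlg.seqAction α)) (ε : ℝ), 0 < ε →
        ∃ y, φ y = z ∧ ‖y‖ ≤ ‖z‖ + ε := fun z ε hε => by
      obtain ⟨y, hy, hyz, hyn⟩ := SeqAlg.exists_lift_piMap hα z.2 hε
      exact ⟨⟨y, hy⟩, Subtype.ext hyz, hyn⟩
    exact ⟨φ, fun _ => rfl, SeqAlg.isEquivariantQuotientMap_of_lift (fun _ _ => rfl)
      (fun y => SeqAlg.norm_piMap_le (y : SeqAlg.LInfty A)) hlift⟩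
  · refine Set.Subset.antisymm ?_ fun z hz => ?_
    · rintro _ ⟨x, hx, rfl⟩
      exact SeqAlg.kappaMap_mem_continuousPart hx
    · obtain ⟨w, hw, hwz, -⟩ := SeqAlg.exists_lift_kappaMap hα hz one_pos
      exact ⟨w, hw, hwz⟩
  · let ψ : SeqAlg.centralContinuousPart α →⋆ₙₐ[ℂ] SeqAlg.continuousPart (SeqAlg.fAction α) :=
      NonUnitalStarAlgHom.codRestrict ((SeqAlg.kappaMap A).comp
        (NonUnitalStarSubalgebraClass.subtype (SeqAlg.centralContinuousPart α))) _
        fun x => SeqAlg.kappaMap_mem_continuousPart x.2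
    have hlift : ∀ (z : SeqAlg.continuousPart (SeqAlg.fAction α)) (ε : ℝ), 0 < ε →
        ∃ y, ψ y = z ∧ ‖y‖ ≤ ‖z‖ + ε := fun z ε hε => by
      obtain ⟨w, hw, hwz, hwn⟩ := SeqAlg.exists_lift_kappaMap hα z.2 hε
      exact ⟨⟨w, hw⟩, Subtype.ext hwz, hwn⟩
    exact ⟨ψ, fun _ => rfl, SeqAlg.isEquivariantQuotientMap_of_lift (fun _ _ => rfl)
      (fun y => SeqAlg.norm_kappaMap_le (y : SeqAlg.centralSeq A)) hlift⟩
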